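/- An entourage on a set $X$ is a set $E\subseteq X\times X$ with $\{(x,x):x\in X\}\subseteq E=E^{-1}$; put $E[x]=\{y\in X:(x,y)\in E\}$. A coarse structure on $X$ is a nonempty family $\mathcal E$ of entourages on $X$ such that for all $E,F\in\mathcal E$ the composition $E\circ F=\{(x,z):\exists y\;(x,y)\in E,\ (y,z)\in F\}$ is contained in some element of $\mathcal E$, and every entourage contained in an element of $\mathcal E$ belongs to $\mathcal E$. It is finitary if $\sup_{x\in X}|E[x]|<\infty$ for every $E\in\mathcal E$. For the group $S_X$ of all bijections of $X$, let $\mathcal E_{S_X}$ be the coarse structure consisting of all entourages contained in one of the sets $\{(x,y)\in X\times X: y\in\{x\}\cup Fx\cup F^{-1}x\}$, where $F$ runs over the finite subsets of $S_X$. A coarse structure $\mathcal E$ on $X$ has asymptotic dimension at most $n$ if for every $E\in\mathcal E$ there are a cover $\mathcal U$ of $X$ and $D\in\mathcal E$ such that $U\times U\subseteq D$ for all $U\in\mathcal U$ and, for every $x\in X$, at most $n+1$ members of $\mathcal U$ meet $E[x]$; the asymptotic dimension of $(X,\mathcal E)$ is the least such integer $n\ge 0$, and is infinite if there is none. **Corollary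 3.3.** Let $X$ be an infinite set. Then $\mathcal E_{S_X}$ is the largest (with respect to inclusion) finitary coarse structure on $X$, and the coarse space $(X,\mathcal E_{S_X})$ has infinite asymptotic dimension. -/

import Mathlib

open scoped Pointwise

/-- An entourage on `X`: a subset of `X × X` that contains the diagonal and is symmetric. -/
def IsEntourage {X : Type*} (E : SetRel X X) : Prop :=
  SetRel.id ⊆ E ∧ E = E.inv

/-- The `E`-ball `E[x] = {y | (x, y) ∈ E}`. -/
def entourageBall {X : Type*} (E : SetRel X X) (x : X) : Set X :=
  {y | (x, y) ∈ E}

/-- A coarse structure on `X`: a nonempty family of (symmetric, reflexive) entourages that is closed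
under taking smaller entourages and under composition. Since the composition of two symmetric
relations need not be symmetric, closure under composition is expressed by requiring that `E ○ F`
is contained in a member of the family. -/
@[ext]
structure CoarseStructure (X : Type*) where
  entourages : Set (SetRel X X)
  isEntourage : ∀ E ∈ entourages, IsEntourage E
  id_mem : SetRel.id ∈ entourages
  comp_mem : ∀ E ∈ entourages, ∀ F ∈ entourages, ∃ H ∈ entourages, SetRel.comp E F ⊆ H
  mem_of_subset : ∀ E ∈ entourages, ∀ F : SetRel X X, IsEntourage F → F ⊆ E → F ∈ entourages

/-- Coarse structures on a fixed set are ordered by inclusion. -/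
instance {X : Type*} : PartialOrder (CoarseStructure X) :=
  PartialOrder.lift CoarseStructure.entourages (fun _ _ h => CoarseStructure.ext h)

/-- A coarse structure is finitary if `sup_x |E[x]| < ∞` for each of its entourages `E`. -/
def CoarseStructure.IsFinitary {X : Type*} (C : CoarseStructure X) : Prop :=
  ∀ E ∈ C.entourages, ∃ m : ℕ, ∀ x : X, (entourageBall E x).encard ≤ m

/-- The entourage `{(x, y) | y ∈ {x} ∪ F x ∪ F⁻¹ x}` defined by a set `F` of bijections of `X`. -/
def permEntourage {X : Type*} (F : Set (Equiv.Perm X)) : SetRel X X :=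
  {p | p.2 = p.1 ∨ (∃ g ∈ F, p.2 = g p.1) ∨ (∃ g ∈ F, p.2 = g⁻¹ p.1)}

theorem isEntourage_permEntourage {X : Type*} (F : Set (Equiv.Perm X)) :
    IsEntourage (permEntourage F) := by
  have key : ∀ x y : X, (x, y) ∈ permEntourage F → (y, x) ∈ permEntourage F := by
    rintro x y (h | ⟨g, hg, h⟩ | ⟨g, hg, h⟩)
    · exact Or.inl h.symm
    · refine Or.inr (Or.inr ⟨g, hg, ?_⟩)
      simp only at h ⊢
      simp [h]
    · refine Or.inr (Or.inl ⟨g, hg, ?_⟩)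
      simp only at h ⊢
      simp [h]
  refine ⟨?_, ?_⟩
  · rintro ⟨x, y⟩ h
    exact Or.inl (Eq.symm h)
  · ext ⟨x, y⟩
    exact ⟨key x y, key y x⟩

theorem mem_permEntourage_iff {X : Type*} (F : Set (Equiv.Perm X)) (x y : X) :
    (x, y) ∈ permEntourage F ↔ ∃ g ∈ ({1} ∪ F ∪ F⁻¹ : Set (Equiv.Perm X)), y = g x := by
  constructor
  · rintro (h | ⟨g, hg, h⟩ | ⟨g, hg, h⟩)
    · exact ⟨1, by simp, h⟩
    · exact ⟨g, by simp [hg], h⟩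
    · exact ⟨g⁻¹, by simp [hg], h⟩
  · rintro ⟨g, (h | h) | h, rfl⟩
    · rw [Set.mem_singleton_iff.1 h]
      exact Or.inl rfl
    · exact Or.inr (Or.inl ⟨g, h, rfl⟩)
    · exact Or.inr (Or.inr ⟨g⁻¹, h, by simp⟩)

/-- The coarse structure `E_G` on `X` generated by a subgroup `G` of the group of all bijections of
`X`: it has the entourages `permEntourage F`, for finite `F ⊆ G`, as a base. -/
def permCoarseStructure {X : Type*} (G : Subgroup (Equiv.Perm X)) : CoarseStructure X where
  entourages := {E | IsEntourage E ∧
    ∃ F : Set (Equiv.Perm X), F.Finite ∧ F ⊆ (G : Set (Equiv.Perm X)) ∧ E ⊆ permEntourage F}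
  isEntourage := fun _ h => h.1
  id_mem := ⟨⟨subset_rfl, SetRel.inv_id.symm⟩, ∅, Set.finite_empty, Set.empty_subset _,
    (isEntourage_permEntourage ∅).1⟩
  comp_mem := by
    rintro E ⟨-, F₁, hF₁, hG₁, h₁⟩ E' ⟨-, F₂, hF₂, hG₂, h₂⟩
    have hsub : ∀ F : Set (Equiv.Perm X), F ⊆ (G : Set (Equiv.Perm X)) →
        ∀ g ∈ ({1} ∪ F ∪ F⁻¹ : Set (Equiv.Perm X)), g ∈ G := by
      rintro F hF g ((h | h) | h)
      · rw [Set.mem_singleton_iff.1 h]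
        exact G.one_mem
      · exact hF h
      · exact inv_mem_iff.1 (hF h)
    refine ⟨permEntourage (({1} ∪ F₂ ∪ F₂⁻¹) * ({1} ∪ F₁ ∪ F₁⁻¹)),
      ⟨isEntourage_permEntourage _, _, ?_, ?_, subset_rfl⟩, ?_⟩
    · exact (((Set.finite_singleton 1).union hF₂).union hF₂.inv).mul
        (((Set.finite_singleton 1).union hF₁).union hF₁.inv)
    · rintro _ ⟨a, ha, b, hb, rfl⟩
      exact G.mul_mem (hsub F₂ hG₂ a ha) (hsub F₁ hG₁ b hb)
    · rintro ⟨x, z⟩ ⟨y, hxy, hyz⟩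
      obtain ⟨b, hb, rfl⟩ := (mem_permEntourage_iff F₁ x y).1 (h₁ hxy)
      obtain ⟨a, ha, rfl⟩ := (mem_permEntourage_iff F₂ _ z).1 (h₂ hyz)
      exact Or.inr (Or.inl ⟨a * b, Set.mul_mem_mul ha hb, rfl⟩)
  mem_of_subset := by
    rintro E ⟨-, F, hF, hG, h⟩ E' hE' hsub
    exact ⟨hE', F, hF, hG, hsub.trans h⟩

/-- A family `U` of subsets of `X` is uniformly bounded if there is one entourage `E` such that
`u × u ⊆ E` for every `u ∈ U`. -/
def CoarseStructure.IsUniformlyBounded {X : Type*} (C : CoarseStructure X) (U : Set (Set X)) :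
    Prop :=
  ∃ E ∈ C.entourages, ∀ u ∈ U, u ×ˢ u ⊆ E

/-- The asymptotic dimension is at most `n`: for each entourage `E` there is a uniformly bounded
cover `U` of `X` such that every ball `E[x]` meets at most `n + 1` members of `U`. -/
def CoarseStructure.AsdimLE {X : Type*} (C : CoarseStructure X) (n : ℕ) : Prop :=
  ∀ E ∈ C.entourages, ∃ U : Set (Set X), ⋃₀ U = Set.univ ∧ C.IsUniformlyBounded U ∧
    ∀ x : X, {u ∈ U | (entourageBall E x ∩ u).Nonempty}.encard ≤ n + 1

/-- The asymptotic dimension: the least `n` with `C.AsdimLE n`, and `⊤` if there is no such `n`. -/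
noncomputable def CoarseStructure.asdim {X : Type*} (C : CoarseStructure X) : ℕ∞ :=
  sInf {d | ∃ n : ℕ, d = n ∧ C.AsdimLE n}

/-! Maximality: if `E` is an entourage of a finitary structure, `E ○ E` has bounded degree, so
finitely many colours separate the points of every ball `E[x]`. Each swap of two colours then
induces a permutation of `X`, and these finitely many permutations cover `E`. Infinite dimension:
`k` involutions acting on the reduced words of length at most `L` give a Cayley graph on a finite
group in which every set `P` of at most `m < L / 2` elements has a neighbourhood of size at least
`(k - 1) * #P` (`card_toggleNbhd`). Double counting shows that any partition into such small pieces
has a ball meeting at least `k - 1` of them. All these graphs embed disjointly in `X` with the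
generators acting as `k` permutations, so `k = n + 3` excludes dimension at most `n`. -/

/-! ### Maximality among finitary coarse structures. -/

/-- Greedy colouring: a graph all of whose vertices have at most `D` neighbours can be properly
coloured with `D + 1` colours. -/
theorem exists_bounded_coloring {X : Type*} (R : X → X → Prop) (hsymm : ∀ x y, R x y → R y x)
    (D : ℕ) (hdeg : ∀ x, {y | R x y}.encard ≤ D) :
    ∃ c : X → ℕ, (∀ x, c x ≤ D) ∧ ∀ x y, R x y → x ≠ y → c x ≠ c y := by
  classical
  let r : X → X → Prop := WellOrderingRel
  have wf : WellFounded r := WellOrderingRel.isWellOrder.wf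
  -- The least colour not taken by an earlier neighbour.
  let c : X → ℕ := wf.fix fun x ih => sInf {n | ∀ y (h : r y x), R x y → ih y h ≠ n}
  have hc : ∀ x, c x = sInf {n | ∀ y, r y x → R x y → c y ≠ n} := fun x => wf.fix_eq _ x
  have hex : ∀ x, ∃ n ≤ D, ∀ y, r y x → R x y → c y ≠ n := by
    intro x
    by_contra! h
    have : Nonempty X := ⟨x⟩
    choose! f hf1 hf2 hf3 using h
    have hinj : Set.InjOn f (Set.Iic D) := by
      intro a ha b hb hab
      rw [← hf3 a ha, ← hf3 b hb, hab]
    have h1 : (f '' Set.Iic D).encard ≤ D := by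
      refine le_trans (Set.encard_le_encard ?_) (hdeg x)
      rintro _ ⟨a, ha, rfl⟩
      exact hf2 a ha
    rw [hinj.encard_image, ← Finset.coe_Iic, Set.encard_coe_eq_coe_finsetCard, Nat.card_Iic] at h1
    have := ENat.natCast_le_natCast.1 h1
    omega
  have hmem : ∀ x y, r y x → R x y → c y ≠ c x := by
    intro x
    obtain ⟨n, -, hn⟩ := hex x
    have := Nat.sInf_mem (s := {n | ∀ y, r y x → R x y → c y ≠ n}) ⟨n, hn⟩
    rw [← hc x] at this
    exact this
  refine ⟨c, fun x => ?_, fun x y hxy hne => ?_⟩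
  · obtain ⟨n, hnD, hn⟩ := hex x
    rw [hc x]
    exact (Nat.sInf_le (show n ∈ {n | ∀ y, r y x → R x y → c y ≠ n} from hn)).trans hnD
  · rcases trichotomous_of WellOrderingRel x y with h | h | h
    · exact hmem y x h (hsymm _ _ hxy)
    · exact absurd h hne
    · exact (hmem x y h hxy).symm

theorem entourage_symm {X : Type*} {E : SetRel X X} (hE : IsEntourage E) {x y : X}
    (h : (x, y) ∈ E) : (y, x) ∈ E := by
  rw [hE.2] at h
  exact h

/-- If a colouring separates the points of every ball `E[x]`, then for each involution `s` of the
colours, moving `x` to the point of `E[x]` of colour `s (c x)`, where there is one, is a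
permutation. -/
theorem exists_perm_of_coloring {X α : Type*} {E : SetRel X X} (hE : IsEntourage E) (c : X → α)
    (hc : ∀ x y z, (x, y) ∈ E → (x, z) ∈ E → c y = c z → y = z)
    (s : α → α) (hs : Function.Involutive s) :
    ∃ g : Equiv.Perm X, ∀ x y, (x, y) ∈ E → c y = s (c x) → g x = y := by
  classical
  -- Points without a target stay fixed, which keeps `f` an involution.
  let f : X → X := fun x => if h : ∃ y, (x, y) ∈ E ∧ c y = s (c x) then h.choose else x
  have hf : ∀ x y, (x, y) ∈ E → c y = s (c x) → f x = y := by
    intro x y hxy hcy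
    have h : ∃ y, (x, y) ∈ E ∧ c y = s (c x) := ⟨y, hxy, hcy⟩
    have : f x = h.choose := dif_pos h
    rw [this]
    exact hc x _ _ h.choose_spec.1 hxy (h.choose_spec.2.trans hcy.symm)
  have hinv : Function.Involutive f := by
    intro x
    by_cases h : ∃ y, (x, y) ∈ E ∧ c y = s (c x)
    · obtain ⟨y, hxy, hcy⟩ := h
      rw [hf x y hxy hcy]
      exact hf y x (entourage_symm hE hxy) (by rw [hcy, hs])
    · have : f x = x := dif_neg h
      rw [this, this]
  exact ⟨hinv.toPerm, hf⟩

theorem isFinitary_permCoarseStructure {X : Type*} (G : Subgroup (Equiv.Perm X)) :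
    (permCoarseStructure G).IsFinitary := by
  rintro E ⟨-, F, hF, -, hEF⟩
  have hfin : ({1} ∪ F ∪ F⁻¹ : Set (Equiv.Perm X)).Finite :=
    ((Set.finite_singleton 1).union hF).union hF.inv
  refine ⟨hfin.toFinset.card, fun x => ?_⟩
  have hsub : entourageBall E x ⊆ (fun g : Equiv.Perm X => g x) '' ({1} ∪ F ∪ F⁻¹) := by
    intro y hy
    obtain ⟨g, hg, rfl⟩ := (mem_permEntourage_iff F x y).1 (hEF hy)
    exact ⟨g, hg, rfl⟩
  refine (Set.encard_le_encard hsub).trans ((Set.encard_image_le _ _).trans ?_)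
  rw [hfin.encard_eq_coe_toFinset_card]

theorem le_permCoarseStructure_top {X : Type*} (C : CoarseStructure X) (hC : C.IsFinitary) :
    C ≤ permCoarseStructure (⊤ : Subgroup (Equiv.Perm X)) := by
  classical
  intro E hE
  have hent := C.isEntourage E hE
  obtain ⟨H, hH, hEH⟩ := C.comp_mem E hE E hE
  obtain ⟨D, hD⟩ := hC H hH
  -- Two points of one ball `E[x]` are joined through `x`, so they get different colours.
  obtain ⟨c, hcD, hc⟩ := exists_bounded_coloring (fun x y => ∃ z, (x, z) ∈ E ∧ (z, y) ∈ E)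
    (fun x y ⟨z, h1, h2⟩ => ⟨z, entourage_symm hent h2, entourage_symm hent h1⟩) D
    (fun x => le_trans (Set.encard_le_encard fun y hy => show (x, y) ∈ H from hEH hy) (hD x))
  have hsep : ∀ x y z, (x, y) ∈ E → (x, z) ∈ E → c y = c z → y = z := by
    intro x y z hy hz h
    by_contra hne
    exact hc y z ⟨x, entourage_symm hent hy, hz⟩ hne h
  choose g hg using fun p : ℕ × ℕ =>
    exists_perm_of_coloring hent c hsep (Equiv.swap p.1 p.2) (Equiv.swap_apply_self _ _)
  refine ⟨hent, g '' (Set.Iic D ×ˢ Set.Iic D),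
    ((Set.finite_Iic D).prod (Set.finite_Iic D)).image g, fun _ _ => Subgroup.mem_top _, ?_⟩
  rintro ⟨x, y⟩ hxy
  exact Or.inr (Or.inl ⟨_, Set.mem_image_of_mem g (Set.mk_mem_prod (hcD x) (hcD y)),
    (hg (c x, c y) x y hxy (Equiv.swap_apply_left _ _).symm).symm⟩)

/-! ### Involutions on a finite ball of reduced words. -/

/-- Words of length at most `L` in the letters `Fin k` without equal adjacent letters: the ball of
radius `L` in the Cayley graph of the free product of `k` groups of order two. -/
abbrev ReducedWord (k L : ℕ) : Type :=
  {w : List (Fin k) // w.IsChain (· ≠ ·) ∧ w.length ≤ L}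

instance (k L : ℕ) : Finite (ReducedWord k L) :=
  Set.Finite.to_subtype (s := {w : List (Fin k) | w.IsChain (· ≠ ·) ∧ w.length ≤ L})
    ((List.finite_length_le (Fin k) L).subset fun _ h => h.2)

/-- Left multiplication by the letter `s` where the result is again a word of length at most
`L`. -/
def ReducedWord.toggle {k L : ℕ} (s : Fin k) (w : ReducedWord k L) : ReducedWord k L :=
  if w.1.head? = some s then ⟨w.1.tail, w.2.1.tail, by have := w.2.2; simp; omega⟩
  else if h : w.1.head? ≠ some s ∧ w.1.length < L then
    ⟨s :: w.1, List.isChain_cons.2 ⟨fun y hy hsy => h.1 (hsy ▸ hy), w.2.1⟩, h.2⟩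
  -- Full-length words that cannot be shortened by `s` are fixed, so that `s` acts as a permutation
  -- of the finite ball.
  else w

theorem ReducedWord.toggle_of_head {k L : ℕ} {s : Fin k} {w : ReducedWord k L}
    (h : w.1.head? = some s) : (w.toggle s).1 = w.1.tail := by
  simp [ReducedWord.toggle, h]

theorem ReducedWord.toggle_of_lt {k L : ℕ} {s : Fin k} {w : ReducedWord k L}
    (h : w.1.head? ≠ some s) (hL : w.1.length < L) : (w.toggle s).1 = s :: w.1 := by
  simp [ReducedWord.toggle, h, hL]

theorem ReducedWord.toggle_of_le {k L : ℕ} {s : Fin k} {w : ReducedWord k L}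
    (h : w.1.head? ≠ some s) (hL : L ≤ w.1.length) : w.toggle s = w := by
  simp [ReducedWord.toggle, h, hL]

theorem ReducedWord.toggle_involutive {k L : ℕ} (s : Fin k) :
    Function.Involutive (ReducedWord.toggle s : ReducedWord k L → ReducedWord k L) := by
  intro w
  by_cases h : w.1.head? = some s
  · obtain ⟨t, ht⟩ : ∃ t, w.1 = s :: t := by
      cases hw : w.1 with
      | nil => simp [hw] at h
      | cons a t => exact ⟨t, by simpa [hw] using h⟩
    have h1 : (w.toggle s).1 = t := by rw [toggle_of_head h, ht, List.tail_cons]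
    have hw1 := w.2.1
    have hw2 := w.2.2
    rw [ht] at hw1 hw2
    refine Subtype.ext ?_
    rw [toggle_of_lt, h1, ht]
    · rw [h1]
      exact fun hs => (List.isChain_cons.1 hw1).1 s hs rfl
    · rw [h1]
      simpa using hw2
  · by_cases hL : w.1.length < L
    · have h1 := toggle_of_lt h hL
      refine Subtype.ext ?_
      rw [toggle_of_head (by rw [h1]; rfl), h1, List.tail_cons]
    · rw [toggle_of_le h (not_lt.1 hL), toggle_of_le h (not_lt.1 hL)]

/-- Keeps the neighbourhoods of sets with well-separated word lengths disjoint. -/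
theorem ReducedWord.length_toggle {k L : ℕ} (s : Fin k) (w : ReducedWord k L) :
    (w.toggle s).1.length ≤ w.1.length + 1 ∧ w.1.length ≤ (w.toggle s).1.length + 1 := by
  by_cases h : w.1.head? = some s
  · rw [toggle_of_head h, List.length_tail]
    omega
  · by_cases hL : w.1.length < L
    · rw [toggle_of_lt h hL, List.length_cons]
      omega
    · rw [toggle_of_le h (not_lt.1 hL)]
      omega

/-- The permutation `ReducedWord.toggle s`. -/
def togglePerm (k L : ℕ) (s : Fin k) : Equiv.Perm (ReducedWord k L) :=
  (ReducedWord.toggle_involutive s).toPerm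

theorem togglePerm_apply {k L : ℕ} (s : Fin k) (w : ReducedWord k L) :
    togglePerm k L s w = w.toggle s := rfl

/-! ### Expansion of small sets. -/

open Classical in
/-- The neighbourhood of a set of group elements in the Cayley graph of the toggles. -/
noncomputable def toggleNbhd {k L : ℕ} (P : Finset (Equiv.Perm (ReducedWord k L))) :
    Finset (Equiv.Perm (ReducedWord k L)) :=
  Finset.univ.biUnion fun s : Fin k => P.image (togglePerm k L s * ·)

theorem mem_toggleNbhd {k L : ℕ} {P : Finset (Equiv.Perm (ReducedWord k L))}
    {h : Equiv.Perm (ReducedWord k L)} :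
    h ∈ toggleNbhd P ↔ ∃ s, ∃ g ∈ P, togglePerm k L s * g = h := by
  simp only [toggleNbhd, Finset.mem_biUnion, Finset.mem_univ, true_and, Finset.mem_image]

/-- Sets that move some word `v` to words of length less than `L` expand by the ping-pong
argument: each `s` maps the words not starting with `s` to words starting with `s`. -/
theorem card_toggleNbhd_of_short {k L : ℕ} (P : Finset (Equiv.Perm (ReducedWord k L)))
    (v : ReducedWord k L) (hP : ∀ g ∈ P, (g v).1.length < L) :
    k * P.card ≤ (toggleNbhd P).card + P.card := by
  classical
  let W : Fin k → Equiv.Perm (ReducedWord k L) → Prop := fun s g => (g v).1.head? = some s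
  have hdisj : ∀ Q : Finset (Equiv.Perm (ReducedWord k L)),
      ∑ s : Fin k, (Q.filter (W s)).card ≤ Q.card := by
    intro Q
    rw [← Finset.card_biUnion]
    · exact Finset.card_le_card (Finset.biUnion_subset.2 fun s _ => Finset.filter_subset _ _)
    · intro s _ t _ hst
      refine Finset.disjoint_left.2 fun g hg hg' => hst ?_
      exact Option.some_injective _
        ((Finset.mem_filter.1 hg).2.symm.trans (Finset.mem_filter.1 hg').2)
  have hmap : ∀ s : Fin k,
      (P.filter (fun g => ¬ W s g)).card ≤ ((toggleNbhd P).filter (W s)).card := by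
    intro s
    refine Finset.card_le_card_of_injOn (togglePerm k L s * ·) ?_
      (fun a _ b _ hab => mul_left_cancel hab)
    intro g hg
    obtain ⟨hgP, hgW⟩ := Finset.mem_filter.1 (Finset.mem_coe.1 hg)
    refine Finset.mem_coe.2 (Finset.mem_filter.2 ⟨mem_toggleNbhd.2 ⟨s, g, hgP, rfl⟩, ?_⟩)
    change ((togglePerm k L s * g) v).1.head? = some s
    rw [Equiv.Perm.mul_apply, togglePerm_apply, ReducedWord.toggle_of_lt hgW (hP g hgP)]
    rfl
  -- For each `s`, split `P` by whether `g v` starts with `s`. The first parts are disjoint in `P`;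
  -- the others inject into disjoint parts of the neighbourhood.
  calc k * P.card = ∑ s : Fin k, P.card := by simp
    _ = ∑ s : Fin k, ((P.filter (W s)).card + (P.filter (fun g => ¬ W s g)).card) :=
        Finset.sum_congr rfl fun s _ => (Finset.card_filter_add_card_filter_not (W s)).symm
    _ ≤ P.card + (toggleNbhd P).card := by
        rw [Finset.sum_add_distrib]
        exact Nat.add_le_add (hdisj P)
          ((Finset.sum_le_sum fun s _ => hmap s).trans (hdisj _))
    _ = _ := Nat.add_comm _ _

/-- A natural-valued function on a finite set `P` misses the values `r + 1` and `r + 2` for some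
`r ≤ 2 * #P`. -/
theorem exists_gap {α : Type*} (P : Finset α) (l : α → ℕ) :
    ∃ r ≤ 2 * P.card, ∀ p ∈ P, l p ≤ r ∨ r + 3 ≤ l p := by
  classical
  by_contra! h
  -- The pairs `{2i + 1, 2i + 2}` with `i ≤ #P` are disjoint, so `P` cannot have a value in each.
  have h' : ∀ i ∈ Finset.range (P.card + 1), ∃ p ∈ P, 2 * i < l p ∧ l p < 2 * i + 3 :=
    fun i hi => h (2 * i) (by have := Finset.mem_range.1 hi; omega)
  have : Nonempty α := ⟨(h' 0 (by simp)).choose⟩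
  choose! f hf1 hf2 using h'
  have := Finset.card_le_card_of_injOn f hf1 (fun a ha b hb hab => by
    have h1 := hf2 a ha
    have h2 := hf2 b hb
    rw [hab] at h1
    omega)
  rw [Finset.card_range] at this
  omega

/-- All small sets expand in the Cayley graph of the toggles. -/
theorem card_toggleNbhd {k L m : ℕ} (hL : 2 * m < L)
    (P : Finset (Equiv.Perm (ReducedWord k L))) (hP : P.card ≤ m) :
    k * P.card ≤ (toggleNbhd P).card + P.card := by
  classical
  induction P using Finset.strongInduction with
  | H P ih =>
    rcases P.eq_empty_or_nonempty with rfl | ⟨p, hp⟩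
    · simp
    let e : ReducedWord k L := ⟨[], List.isChain_nil, Nat.zero_le _⟩
    -- This `v` is sent by `p` to the empty word, so `p` falls in `A` and the induction applies to
    -- `B`.
    let v : ReducedWord k L := p⁻¹ e
    let l : Equiv.Perm (ReducedWord k L) → ℕ := fun g => (g v).1.length
    have hlp : l p = 0 := by simp [l, v, e]
    obtain ⟨r, hr, hgap⟩ := exists_gap P l
    let A := P.filter (fun g => l g ≤ r)
    let B := P.filter (fun g => ¬ l g ≤ r)
    have hAB : A.card + B.card = P.card := Finset.card_filter_add_card_filter_not _
    have hBP : B ⊂ P := Finset.filter_ssubset.2 ⟨p, hp, by simp [hlp]⟩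
    have hA := card_toggleNbhd_of_short A v fun g hg => by
      have : l g ≤ r := (Finset.mem_filter.1 hg).2
      change l g < L
      omega
    have hB := ih B hBP (by omega)
    have hstep : ∀ s g, l (togglePerm k L s * g) ≤ l g + 1 ∧ l g ≤ l (togglePerm k L s * g) + 1 :=
      fun s g => ReducedWord.length_toggle s (g v)
    -- Lengths are at most `r + 1` in the first set and at least `r + 2` in the second.
    have hdisj : Disjoint (toggleNbhd A) (toggleNbhd B) := by
      refine Finset.disjoint_left.2 fun h hhA hhB => ?_
      obtain ⟨s, a, ha, rfl⟩ := mem_toggleNbhd.1 hhA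
      obtain ⟨t, b, hb, hab⟩ := mem_toggleNbhd.1 hhB
      have h1 := hstep s a
      have h2 := hstep t b
      have h3 : l a ≤ r := (Finset.mem_filter.1 ha).2
      obtain ⟨hbP, h4⟩ := Finset.mem_filter.1 hb
      have h5 := hgap b hbP
      rw [hab] at h2
      omega
    have hsub : toggleNbhd A ∪ toggleNbhd B ⊆ toggleNbhd P := by
      intro h hh
      rcases Finset.mem_union.1 hh with hh | hh <;>
      · obtain ⟨s, g, hg, rfl⟩ := mem_toggleNbhd.1 hh
        exact mem_toggleNbhd.2 ⟨s, g, (Finset.mem_filter.1 hg).1, rfl⟩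
    have hcard := Finset.card_le_card hsub
    rw [Finset.card_union_of_disjoint hdisj] at hcard
    rw [← hAB, Nat.mul_add]
    omega

/-! ### Double counting and transfer to `X`. -/

/-- In a partition of the Cayley graph of the toggles into pieces with at most `m` elements, some
ball meets at least `k - 1` pieces. -/
theorem exists_ball_meeting_many {k L m n : ℕ} {α : Type*} (hL : 2 * m < L) (hk : n + 3 ≤ k)
    (φ : Equiv.Perm (ReducedWord k L) → α) (hφ : ∀ u, {g | φ g = u}.encard ≤ m) :
    ∃ h, ((n + 1 : ℕ) : ℕ∞) < {u | ∃ s, ∃ g, togglePerm k L s * g = h ∧ φ g = u}.encard := by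
  classical
  by_contra! hcon
  have : Fintype (Equiv.Perm (ReducedWord k L)) := Fintype.ofFinite _
  let P : α → Finset (Equiv.Perm (ReducedWord k L)) := fun u => Finset.univ.filter (φ · = u)
  let T : Finset α := Finset.univ.image φ
  have hPcard : ∀ u, (P u).card ≤ m := by
    intro u
    have h := hφ u
    rw [show {g | φ g = u} = (P u : Set _) by ext; simp [P], Set.encard_coe_eq_coe_finsetCard] at h
    exact ENat.natCast_le_natCast.1 h
  have hsum : ∑ u ∈ T, (P u).card = Fintype.card (Equiv.Perm (ReducedWord k L)) :=
    (Finset.card_eq_sum_card_image φ Finset.univ).symm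
  have hdc : ∑ u ∈ T, (toggleNbhd (P u)).card =
      ∑ h : Equiv.Perm (ReducedWord k L), (T.filter fun u => h ∈ toggleNbhd (P u)).card := by
    have := Finset.sum_card_bipartiteAbove_eq_sum_card_bipartiteBelow
      (s := T) (t := Finset.univ) (fun u h => h ∈ toggleNbhd (P u))
    simpa [Finset.bipartiteAbove, Finset.bipartiteBelow] using this
  have hle : ∀ h, (T.filter fun u => h ∈ toggleNbhd (P u)).card ≤ n + 1 := by
    intro h
    rw [← ENat.natCast_le_natCast, ← Set.encard_coe_eq_coe_finsetCard]
    refine (Set.encard_le_encard ?_).trans (hcon h)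
    intro u hu
    obtain ⟨s, g, hg, hs⟩ := mem_toggleNbhd.1 (Finset.mem_filter.1 (Finset.mem_coe.1 hu)).2
    exact ⟨s, g, hs, (Finset.mem_filter.1 hg).2⟩
  -- Expansion makes the neighbourhoods' sizes sum to at least `n + 2` times the group order, but
  -- `hle` allows only `n + 1` times.
  have h1 : ∑ u ∈ T, k * (P u).card ≤ ∑ u ∈ T, ((toggleNbhd (P u)).card + (P u).card) :=
    Finset.sum_le_sum fun u _ => card_toggleNbhd hL (P u) (hPcard u)
  rw [← Finset.mul_sum, Finset.sum_add_distrib, hsum, hdc] at h1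
  have h2 := Finset.sum_le_sum fun (h : Equiv.Perm (ReducedWord k L)) (_ : h ∈ Finset.univ) => hle h
  rw [Finset.sum_const, Finset.card_univ, smul_eq_mul] at h2
  have h3 : 0 < Fintype.card (Equiv.Perm (ReducedWord k L)) := Fintype.card_pos
  nlinarith

/-- The toggles of the groups `Equiv.Perm (ReducedWord k L)` for all `L` act simultaneously on any
infinite set. -/
theorem exists_toggle_action (X : Type*) [Infinite X] (k : ℕ) :
    ∃ (τ : Fin k → Equiv.Perm X) (ι : ∀ L, Equiv.Perm (ReducedWord k L) ↪ X),
      ∀ s L g, τ s (ι L g) = ι L (togglePerm k L s * g) := by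
  classical
  let Y := Σ L, Equiv.Perm (ReducedWord k L)
  obtain ⟨f, hf⟩ := exists_injective_nat Y
  let j : Y ↪ X := Function.Embedding.trans ⟨f, hf⟩ (Infinite.natEmbedding X)
  -- Left multiplication on each group, extended by the identity off the image of `j`.
  refine ⟨fun s => Equiv.Perm.viaEmbedding
      (Equiv.Perm.sigmaCongrRight fun L => Equiv.mulLeft (togglePerm k L s)) j,
    fun L => (Function.Embedding.sigmaMk L).trans j, fun s L g => ?_⟩
  exact Equiv.Perm.viaEmbedding_apply _ j ⟨L, g⟩

theorem not_asdimLE_permCoarseStructure_top (X : Type*) [Infinite X] (n : ℕ) :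
    ¬ (permCoarseStructure (⊤ : Subgroup (Equiv.Perm X))).AsdimLE n := by
  intro hn
  obtain ⟨τ, ι, hτ⟩ := exists_toggle_action X (n + 3)
  have hE : permEntourage (Set.range τ) ∈
      (permCoarseStructure (⊤ : Subgroup (Equiv.Perm X))).entourages :=
    ⟨isEntourage_permEntourage _, _, Set.finite_range τ, fun _ _ => Subgroup.mem_top _, subset_rfl⟩
  obtain ⟨U, hU, ⟨D, hD, hUD⟩, hball⟩ := hn _ hE
  obtain ⟨m, hm⟩ := isFinitary_permCoarseStructure _ D hD
  have hcov : ∀ x : X, ∃ u ∈ U, x ∈ u := fun x => by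
    have : x ∈ ⋃₀ U := hU ▸ Set.mem_univ x
    exact this
  -- Choosing one member of the cover per point turns the cover into a partition, with pieces of
  -- size at most `m` because `D` is finitary.
  choose ψ hψU hψ using hcov
  let L := 2 * m + 1
  obtain ⟨h, hh⟩ := exists_ball_meeting_many (n := n) (L := L) (Nat.lt_succ_self (2 * m)) le_rfl
    (fun g => ψ (ι L g)) (fun u => by
      rcases Set.eq_empty_or_nonempty {g | ψ (ι L g) = u} with he | ⟨g₀, hg₀⟩
      · rw [he, Set.encard_empty]
        exact zero_le
      · rw [← (ι L).injective.encard_image]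
        refine (Set.encard_le_encard ?_).trans (hm (ι L g₀))
        rintro _ ⟨g, hg, rfl⟩
        have hu : u ∈ U := hg₀ ▸ hψU _
        have h1 : ι L g₀ ∈ u := Eq.subst (motive := fun w => ι L g₀ ∈ w) hg₀ (hψ _)
        have h2 : ι L g ∈ u := Eq.subst (motive := fun w => ι L g ∈ w) hg (hψ _)
        exact hUD u hu ⟨h1, h2⟩)
  refine absurd ((Set.encard_le_encard ?_).trans (hball (ι L h))) (not_le.2 (by exact_mod_cast hh))
  rintro u ⟨s, g, rfl, rfl⟩
  refine ⟨hψU _, ι L g, Or.inr (Or.inr ⟨τ s, ⟨s, rfl⟩, ?_⟩), hψ _⟩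
  exact (Equiv.Perm.inv_eq_iff_eq.2 (hτ s L g).symm).symm

theorem corollary3p3 (X : Type*) [Infinite X] :
    IsGreatest {C : CoarseStructure X | C.IsFinitary}
      (permCoarseStructure (⊤ : Subgroup (Equiv.Perm X))) ∧
    (permCoarseStructure (⊤ : Subgroup (Equiv.Perm X))).asdim = ⊤ := by
  refine ⟨⟨isFinitary_permCoarseStructure _, fun C hC => le_permCoarseStructure_top C hC⟩, ?_⟩
  rw [CoarseStructure.asdim, sInf_eq_top]
  rintro _ ⟨n, -, hn⟩
  exact absurd hn (not_asdimLE_permCoarseStructure_top X n)
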